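/- **Theorem.** Algebras are not assumed associative or unital. Let $F$ be a field of characteristic $\neq 2$ and let $\mathcal V$ be a variety of flexible $F$-algebras (that is, algebras with $(x,y,x)=0$, where $(x,y,z)=(xy)z-x(yz)$) such that every finitely generated anticommutative algebra ($x^2=0$) in $\mathcal V$ is nilpotent. If $F$ is finite, assume moreover that $\mathcal V$ is homogeneous, i.e. that every homogeneous component (with respect to the degree) of an identity of $\mathcal V$ is again an identity of $\mathcal V$ (equivalently, the free $\mathcal V$-algebras are graded by degree; for infinite $F$ this holds automatically). Define polynomials $f_k$ in $k$ variables by $f_1(x)=x$, $f_2(x_1,x_2)=[x_1,x_2]=x_1x_2-x_2x_1$ and, for $m\ge 2$, $$f_{m+1}(x_1,\ldots,x_{m+1})=\sum_{1\le i<j\le m+1}(-1)^{i+j-1}f_m([x_i,x_j],x_1,\ldots,\check x_i,\ldots,\check x_j,\ldots,x_{m+1}),$$ where $\check x_i$ means that $x_i$ is omitted. Let $\mathcal V_n$ denote the variety generated by the free $\mathcal V$-algebra of rank $n$; the basic rank $r_b(\mathcal V)$ is the least $n$ with $\mathcal V_n=\mathcal V$, and it is infinite if there is no such $n$. Then: 1.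 For every $m$ there is an $N=N(m)\ge 1$ such that every $m$-generated algebra in $\mathcal V$ satisfies the identity $f_N=0$. 2. If for every $k\ge 1$ the polynomial $f_k$ is nonzero in the free $\mathcal V$-algebra of countable rank (i.e. $f_k(x_1,\ldots,x_k)\neq 0$ for free generators $x_1,\dots,x_k$), then $r_b(\mathcal V)$ is infinite. 3. If $F$ has characteristic $0$ and $\mathcal V$ contains the variety of alternative algebras (the algebras with $(x,x,y)=(x,y,y)=0$), then $f_k$ is nonzero in the free $\mathcal V$-algebra of countable rank for every $k\ge 1$; consequently $r_b(\mathcal V)$ is infinite. -/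

import Mathlib

universe u

noncomputable section

namespace FlexVar

/-! Algebras over a field are neither assumed associative nor unital. -/

section Algebras

variable (A : Type u) [NonUnitalNonAssocRing A]

/-- Flexible algebras: the associator identity `(x, y, x) = 0`. -/
def IsFlexible : Prop := ∀ x y : A, associator x y x = 0

/-- Alternative algebras: the identities `(x, x, y) = 0` and `(x, y, y) = 0`. -/
def IsAlternative : Prop :=
  (∀ x y : A, associator x x y = 0) ∧ (∀ x y : A, associator x y y = 0)

/-- Anticommutative algebras: the identity `x ^ 2 = 0`. -/
def IsAnticommutative : Prop := ∀ x : A, x * x = 0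

/-- An algebra is nilpotent if, for some `n`, every product of at least `n` of its elements,
with any arrangement of brackets, is zero. A bracketed product of elements of `A` is an element
of the free magma on `A`; its value is computed by the lift of the identity map. -/
def IsNilpotentAlgebra : Prop :=
  ∃ n : ℕ, ∀ w : FreeMagma A, n ≤ w.length → FreeMagma.lift (id : A → A) w = 0

end Algebras

/-- The polynomials `f_k`, evaluated at `k` elements of an algebra:
`f_1(x) = x`, `f_2(x_1, x_2) = [x_1, x_2]`, and `f_{m+1}(x_1, …, x_{m+1})` is the sum over `i < j`
of `(-1)^(i+j-1) f_m([x_i, x_j], x_1, …, x_{m+1})`, with `x_i` and `x_j` omitted from the list.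
Here the variables are numbered from `0`, which turns the sign into `(-1)^(i+j+1)`.
The value for `k = 0` is a placeholder and is never used. -/
def skewPoly {A : Type u} [NonUnitalNonAssocRing A] : (k : ℕ) → (Fin k → A) → A
  | 0, _ => 0
  | 1, x => x 0
  | 2, x => x 0 * x 1 - x 1 * x 0
  | (m + 3), x =>
      ∑ i : Fin (m + 3), ∑ j : Fin (m + 3),
        if h : i < j then
          ((-1 : ℤ) ^ ((i : ℕ) + (j : ℕ) + 1)) •
            skewPoly (m + 2)
              (Fin.cons (x i * x j - x j * x i)
                ((i.castLT (lt_of_lt_of_le h (Nat.lt_succ_iff.mp j.isLt))).removeNth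
                  (j.removeNth x)))
        else 0

section Generation

variable (F : Type u) [Field F] (A : Type u) [NonUnitalNonAssocRing A] [Module F A]
  [IsScalarTower F A A] [SMulCommClass F A A]

/-- `A` is generated, as an `F`-algebra, by `m` elements. -/
def IsGeneratedBy (m : ℕ) : Prop :=
  ∃ x : Fin m → A, NonUnitalAlgebra.adjoin F (Set.range x) = ⊤

/-- `A` is a finitely generated `F`-algebra. -/
def IsFinGenerated : Prop := ∃ m : ℕ, IsGeneratedBy F A m

/-- The identities of the algebra `A`: the nonassociative polynomials in countably many
variables which vanish under every substitution of elements of `A`. -/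
def identitiesOf : Set (FreeNonUnitalNonAssocAlgebra F ℕ) :=
  {g | ∀ φ : ℕ → A, FreeNonUnitalNonAssocAlgebra.lift F φ g = 0}

end Generation

section Varieties

variable {F : Type u} [Field F]

/-- The algebra `A` belongs to the variety defined by the set `I` of identities. -/
def InVariety (I : Set (FreeNonUnitalNonAssocAlgebra F ℕ)) (A : Type u)
    [NonUnitalNonAssocRing A] [Module F A] [IsScalarTower F A A] [SMulCommClass F A A] : Prop :=
  I ⊆ identitiesOf F A

variable (I : Set (FreeNonUnitalNonAssocAlgebra F ℕ))

/-- Two nonassociative polynomials with variables in `X` are identified if they take the same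
values in every algebra of the variety, under every substitution. -/
def relFreeCon (X : Type) : RingCon (FreeNonUnitalNonAssocAlgebra F X) where
  r a b := ∀ (A : Type u) [NonUnitalNonAssocRing A] [Module F A] [IsScalarTower F A A]
    [SMulCommClass F A A], InVariety I A → ∀ φ : X → A,
      FreeNonUnitalNonAssocAlgebra.lift F φ a = FreeNonUnitalNonAssocAlgebra.lift F φ b
  iseqv :=
    { refl := fun _ A _ _ _ _ _ _ => rfl
      symm := fun h A _ _ _ _ hA φ => (h A hA φ).symm
      trans := fun h h' A _ _ _ _ hA φ => (h A hA φ).trans (h' A hA φ) }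
  add' := fun h h' A _ _ _ _ hA φ => by
    rw [map_add, map_add, h A hA φ, h' A hA φ]
  mul' := fun h h' A _ _ _ _ hA φ => by
    rw [map_mul, map_mul, h A hA φ, h' A hA φ]

/-- The free algebra of the variety on the set `X` of free generators. -/
def RelFree (X : Type) : Type u := (relFreeCon I X).Quotient

namespace RelFree

variable (X : Type)

instance : NonUnitalNonAssocRing (RelFree I X) :=
  inferInstanceAs (NonUnitalNonAssocRing (relFreeCon I X).Quotient)

/-- The canonical projection of the free nonassociative algebra. -/
def mk : FreeNonUnitalNonAssocAlgebra F X →ₙ+* RelFree I X where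
  toFun a := ((a : (relFreeCon I X).Quotient))
  map_mul' _ _ := rfl
  map_zero' := rfl
  map_add' _ _ := rfl

theorem mk_surjective : Function.Surjective (mk I X) := fun a =>
  Quotient.inductionOn' a fun b => ⟨b, rfl⟩

instance : SMul F (RelFree I X) where
  smul c := Quotient.map' (fun a => c • a) fun _ _ h A _ _ _ _ hA φ => by
    rw [map_smul, map_smul, h A hA φ]

theorem mk_smul (c : F) (a : FreeNonUnitalNonAssocAlgebra F X) :
    mk I X (c • a) = c • mk I X a := rfl

instance : Module F (RelFree I X) :=
  (mk_surjective I X).module F (mk I X).toAddMonoidHom (mk_smul I X)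

instance : IsScalarTower F (RelFree I X) (RelFree I X) where
  smul_assoc c a b := by
    obtain ⟨a, rfl⟩ := mk_surjective I X a
    obtain ⟨b, rfl⟩ := mk_surjective I X b
    simp only [smul_eq_mul, ← mk_smul, ← map_mul, smul_mul_assoc]

instance : SMulCommClass F (RelFree I X) (RelFree I X) where
  smul_comm c a b := by
    obtain ⟨a, rfl⟩ := mk_surjective I X a
    obtain ⟨b, rfl⟩ := mk_surjective I X b
    simp only [smul_eq_mul, ← mk_smul, ← map_mul, mul_smul_comm]

/-- The free generators. -/
def gen (x : X) : RelFree I X := mk I X (FreeNonUnitalNonAssocAlgebra.of F x)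

end RelFree

/-- The variety generated by its free algebra of rank `n` (that is, the class of all algebras
that satisfy every identity of this free algebra) is the whole variety. -/
def GeneratedInRank (n : ℕ) : Prop :=
  ∀ (A : Type u) [NonUnitalNonAssocRing A] [Module F A] [IsScalarTower F A A]
    [SMulCommClass F A A],
    InVariety (identitiesOf F (RelFree I (Fin n))) A ↔ InVariety I A

/-- The basic rank: the least `n` such that the variety is generated by its free algebra of
rank `n`, and `⊤` (infinity) if there is no such `n`. -/
def basicRank : ℕ∞ := sInf {r : ℕ∞ | ∃ n : ℕ, r = n ∧ GeneratedInRank I n}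

open Classical in
/-- The homogeneous component of degree `d` of a nonassociative polynomial. -/
def homogeneousComponent (d : ℕ) (a : FreeNonUnitalNonAssocAlgebra F ℕ) :
    FreeNonUnitalNonAssocAlgebra F ℕ :=
  .ofCoeff (a.coeff.filter fun w => w.length = d)

/-- The variety is homogeneous: the homogeneous components of an identity of the variety are
again identities of the variety, so that its free algebras are graded by the degree. -/
def IsHomogeneousVariety : Prop :=
  ∀ a : FreeNonUnitalNonAssocAlgebra F ℕ, RelFree.mk I ℕ a = 0 →
    ∀ d : ℕ, RelFree.mk I ℕ (homogeneousComponent d a) = 0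

end Varieties

end FlexVar

end

set_option linter.unusedSectionVars false

namespace FlexVar

/-! ### Compatibility with homomorphisms -/

section Functoriality

/-! Write x∘y = xy + yx. Each f_k is alternating (`skewPoly_succ`), and in a flexible algebra
f_k(x², x, …) = 0 for k ≥ 2 (`skewAlt_vanishesOnSquares`), since [x², z] = x∘[x, z]. Linearizing
gives f(x∘y, z, …) = f(x, y∘z, …) + f(y, x∘z, …), so factors of one argument can be pushed into
another. If a finite set V generates the algebra under ∘, all arguments but one can thus be reduced
to elements of V, and with |V| + 2 arguments two of them coincide: f vanishes
(`VanishesOnSquares.eq_zero`).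

Such a V exists in the free algebra of rank m. The squares span an ideal; the quotient is
anticommutative and finitely generated, hence nilpotent, so long words are combinations of squares.
By homogeneity a long word is then a combination of u∘v with u, v shorter words, and the finitely
many short words generate under ∘. This gives (1). For (2), the resulting f_N is an identity of the
free algebra of rank n but not of the variety.

For (3), `NullExtension` is an alternative algebra on which f_{m+1}, with m arguments in V, acts on
E × E by an invertible 2×2 matrix times the exterior product of these arguments. The determinant
gains the factor -3(m+1)² at each step, nonzero in characteristic 0. -/

theorem map_skewPoly {A B G : Type*} [NonUnitalNonAssocRing A] [NonUnitalNonAssocRing B]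
    [FunLike G A B] [NonUnitalRingHomClass G A B] (f : G) :
    ∀ (k : ℕ) (x : Fin k → A), f (skewPoly k x) = skewPoly k (fun i => f (x i))
  | 0, x => by simp [skewPoly]
  | 1, x => by simp [skewPoly]
  | 2, x => by simp [skewPoly]
  | (m + 3), x => by
      simp only [skewPoly, map_sum]
      refine Finset.sum_congr rfl fun i _ => Finset.sum_congr rfl fun j _ => ?_
      split_ifs with h
      · rw [map_zsmul, map_skewPoly f (m + 2)]
        congr 2
        funext l
        refine Fin.cases ?_ (fun l => ?_) l
        · simp
        · simp [Fin.removeNth]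
      · exact map_zero f

end Functoriality

/-! ### The polynomials as alternating maps -/

section Alternating

variable (F : Type*) [Field F] (A : Type*) [NonUnitalNonAssocRing A] [Module F A]
  [IsScalarTower F A A] [SMulCommClass F A A]

/-- The polynomial `f_{k+1}` as an alternating map. -/
noncomputable def skewAlt : (k : ℕ) → A [⋀^Fin (k + 1)]→ₗ[F] A
  | 0 => AlternatingMap.ofSubsingleton F A A (0 : Fin 1) LinearMap.id
  -- Alternating successively over the two factors of the product visits each pair in both orders
  -- with opposite signs, which produces the commutators.
  | (k + 1) => AlternatingMap.alternatizeUncurryFin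
      (AlternatingMap.alternatizeUncurryFinLM ∘ₗ
        (LinearMap.mul F A).compr₂ (skewAlt k).curryLeft)

variable {F A}

theorem skewAlt_succ_apply (k : ℕ) (v : Fin (k + 2) → A) :
    skewAlt F A (k + 1) v = ∑ i : Fin (k + 2), (-1) ^ (i : ℕ) • ∑ j : Fin (k + 1),
      (-1) ^ (j : ℕ) • skewAlt F A k
        (Fin.cons (v i * i.removeNth v j) (j.removeNth (i.removeNth v))) := by
  simp [skewAlt, AlternatingMap.alternatizeUncurryFin_apply, Matrix.vecCons]

theorem skewAlt_succ_apply' (k : ℕ) (v : Fin (k + 2) → A) :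
    skewAlt F A (k + 1) v = ∑ i : Fin (k + 1), ∑ j ≥ i, (-1 : ℤ) ^ ((i : ℕ) + (j : ℕ)) •
      skewAlt F A k (Fin.cons (v i.castSucc * v j.succ - v j.succ * v i.castSucc)
        (j.removeNth (i.castSucc.removeNth v))) := by
  rw [skewAlt, AlternatingMap.alternatizeUncurryFin_alternatizeUncurryFinLM_comp_apply]
  refine Finset.sum_congr rfl fun i _ => Finset.sum_congr rfl fun j _ => ?_
  congr 1
  have : ∀ a b : A, ∀ w : Fin k → A, skewAlt F A k (Fin.cons (a - b) w) =
      skewAlt F A k (Fin.cons a w) - skewAlt F A k (Fin.cons b w) := fun a b w => by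
    have := LinearMap.map_sub (skewAlt F A k).curryLeft a b
    exact congrArg (fun g => g w) this
  rw [this]
  simp [Matrix.vecCons]

theorem skewPoly_succ : ∀ (k : ℕ) (v : Fin (k + 1) → A), skewPoly (k + 1) v = skewAlt F A k v
  | 0, v => by simp [skewPoly, skewAlt]
  | 1, v => by
      rw [skewAlt_succ_apply']
      simp [skewPoly, skewAlt]
  | (k + 2), v => by
      rw [skewAlt_succ_apply', skewPoly, Fin.sum_univ_castSucc]
      have hlast : ∀ j : Fin (k + 3), ¬ Fin.last (k + 2) < j := fun j =>
        not_lt.2 (Fin.le_last j)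
      simp only [hlast, dite_false, Finset.sum_const_zero, add_zero]
      refine Finset.sum_congr rfl fun i _ => ?_
      rw [Fin.sum_univ_succ]
      simp only [Fin.not_lt_zero, dite_false, zero_add]
      rw [← Finset.sum_filter_add_sum_filter_not Finset.univ (fun j => i ≤ j)]
      rw [Finset.sum_eq_zero (s := Finset.filter (fun j => ¬ i ≤ j) Finset.univ), add_zero]
      · refine Finset.sum_congr (by ext; simp) fun j hj => ?_
        have hij : i ≤ j := by simpa using hj
        rw [dif_pos (Fin.castSucc_lt_succ_iff.2 hij), skewPoly_succ (k + 1)]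
        congr 1
        · simp only [Fin.val_castSucc, Fin.val_succ]
          rw [← add_assoc, add_assoc _ 1 1, pow_add]
          simp
        · congr 1
          congr 1
          -- The two sides delete the same two entries in opposite orders.
          rw [Fin.removeNth_removeNth_eq_swap]
          simp [Fin.predAbove, Fin.succAbove, hij]
      · intro j hj
        rw [dif_neg]
        simpa [Fin.castSucc_lt_succ_iff] using hj

end Alternating

/-! ### Vanishing on squares and the cyclic identity -/

section Cyclic

variable {F : Type*} [Field F] {A : Type*} [NonUnitalNonAssocRing A] [Module F A]
  [IsScalarTower F A A] [SMulCommClass F A A] {n : ℕ}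

theorem IsFlexible.associator_add (hA : IsFlexible A) (x y z : A) :
    associator x y z + associator z y x = 0 := by
  have h := hA (x + z) y
  have h1 := hA x y
  have h2 := hA z y
  simp only [associator, add_mul, mul_add] at *
  linear_combination (norm := abel) h - h1 - h2

/-- In a flexible algebra the commutator with `z` is a derivation of the product
`x * y + y * x`, evaluated at a square. -/
theorem IsFlexible.commutator_sq (hA : IsFlexible A) (x z : A) :
    x * x * z - z * (x * x) = x * (x * z - z * x) + (x * z - z * x) * x := by
  have h := hA.associator_add x x z
  have h1 := hA x z
  simp only [associator] at *
  simp only [mul_sub, sub_mul]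
  linear_combination (norm := abel) h - h1

/-- An alternating map which vanishes as soon as one argument is the square of another one. -/
def VanishesOnSquares (φ : A [⋀^Fin n]→ₗ[F] A) : Prop :=
  ∀ (v : Fin n → A) (p q : Fin n), p ≠ q → v p = v q * v q → φ v = 0

theorem exists_perm_zero_one {p q : Fin (n + 2)} (hpq : p ≠ q) :
    ∃ σ : Equiv.Perm (Fin (n + 2)), σ 0 = p ∧ σ 1 = q := by
  have h01 : (0 : Fin (n + 2)) ≠ 1 := by simp
  have hq : (0 : Fin (n + 2)) ≠ Equiv.swap 0 p q := fun h0 => by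
    have := congrArg (Equiv.swap 0 p) h0
    simp only [Equiv.swap_apply_left, Equiv.swap_apply_self] at this
    exact hpq this
  refine ⟨Equiv.swap 0 p * Equiv.swap 1 (Equiv.swap 0 p q), ?_, ?_⟩
  · rw [Equiv.Perm.mul_apply, Equiv.swap_apply_of_ne_of_ne h01 hq, Equiv.swap_apply_left]
  · rw [Equiv.Perm.mul_apply, Equiv.swap_apply_left, Equiv.swap_apply_self]

theorem vanishesOnSquares_of_zero_one (φ : A [⋀^Fin (n + 2)]→ₗ[F] A)
    (h : ∀ (x : A) (w : Fin n → A), φ (Fin.cons (x * x) (Fin.cons x w)) = 0) :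
    VanishesOnSquares φ := by
  intro v p q hpq hv
  obtain ⟨σ, h0, h1⟩ := exists_perm_zero_one hpq
  have hvσ : v ∘ σ = Fin.cons (v q * v q) (Fin.cons (v q) fun i => v (σ i.succ.succ)) := by
    funext i
    refine Fin.cases ?_ (fun i => Fin.cases ?_ (fun i => ?_) i) i
    · simp [h0, hv]
    · simp [h1]
    · simp
  have := φ.map_perm v σ
  rw [hvσ, h] at this
  rcases Int.units_eq_one_or (Equiv.Perm.sign σ) with hs | hs <;> rw [hs] at this
  · simpa using this.symm
  · simpa using this.symm

theorem map_cons_add (φ : A [⋀^Fin (n + 1)]→ₗ[F] A) (x y : A) (w : Fin n → A) :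
    φ (Fin.cons (x + y) w) = φ (Fin.cons x w) + φ (Fin.cons y w) :=
  congrArg (fun g => g w) (φ.curryLeft.map_add x y)

theorem map_cons_neg (φ : A [⋀^Fin (n + 1)]→ₗ[F] A) (x : A) (w : Fin n → A) :
    φ (Fin.cons (-x) w) = -φ (Fin.cons x w) :=
  congrArg (fun g => g w) (φ.curryLeft.map_neg x)

theorem map_cons_sub (φ : A [⋀^Fin (n + 1)]→ₗ[F] A) (x y : A) (w : Fin n → A) :
    φ (Fin.cons (x - y) w) = φ (Fin.cons x w) - φ (Fin.cons y w) :=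
  congrArg (fun g => g w) (φ.curryLeft.map_sub x y)

theorem map_cons_cons_add (φ : A [⋀^Fin (n + 2)]→ₗ[F] A) (z x y : A) (w : Fin n → A) :
    φ (Fin.cons z (Fin.cons (x + y) w)) =
      φ (Fin.cons z (Fin.cons x w)) + φ (Fin.cons z (Fin.cons y w)) :=
  congrArg (fun g => g w) ((φ.curryLeft z).curryLeft.map_add x y)

theorem map_cons_cons_neg (φ : A [⋀^Fin (n + 2)]→ₗ[F] A) (z x : A) (w : Fin n → A) :
    φ (Fin.cons z (Fin.cons (-x) w)) = -φ (Fin.cons z (Fin.cons x w)) :=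
  congrArg (fun g => g w) ((φ.curryLeft z).curryLeft.map_neg x)

theorem map_cons_cons_swap (φ : A [⋀^Fin (n + 2)]→ₗ[F] A) (x y : A) (w : Fin n → A) :
    φ (Fin.cons x (Fin.cons y w)) = -φ (Fin.cons y (Fin.cons x w)) := by
  have h : ∀ z, φ (Fin.cons z (Fin.cons z w)) = 0 := fun z =>
    φ.map_eq_zero_of_eq _ (i := 0) (j := 1) (by simp) (by simp)
  have := h (x + y)
  rw [map_cons_add, map_cons_cons_add, map_cons_cons_add, h, h, zero_add, add_zero] at this
  exact eq_neg_of_add_eq_zero_left this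

theorem eq_zero_of_add_self (h2 : (2 : F) ≠ 0) {a : A} (h : a + a = 0) : a = 0 := by
  rw [← two_smul F] at h
  exact (smul_eq_zero.1 h).resolve_left h2

/-- Comparing the values at x + y and x - y leaves twice the part odd in y; the cubic term in y
vanishes by itself. Only division by 2 is needed, so small fields cause no trouble. -/
theorem VanishesOnSquares.map_sq_add (h2 : (2 : F) ≠ 0) {φ : A [⋀^Fin (n + 2)]→ₗ[F] A}
    (h : VanishesOnSquares φ) (x y : A) (w : Fin n → A) :
    φ (Fin.cons (x * y + y * x) (Fin.cons x w)) + φ (Fin.cons (x * x) (Fin.cons y w)) = 0 := by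
  have key : ∀ z, φ (Fin.cons (z * z) (Fin.cons z w)) = 0 := fun z =>
    h _ 0 1 (by simp) (by simp)
  have hp := key (x + y)
  have hm := key (x + -y)
  have e1 : (x + y) * (x + y) = x * x + (x * y + y * x) + y * y := by
    simp only [add_mul, mul_add]; abel
  have e2 : (x + -y) * (x + -y) = x * x + -(x * y + y * x) + y * y := by
    simp only [add_mul, mul_add, mul_neg, neg_mul]; abel
  rw [e1] at hp
  rw [e2] at hm
  simp only [map_cons_cons_add, map_cons_cons_neg, map_cons_add φ (x * x + _),
    map_cons_add φ (x * x), map_cons_neg, key x, key y] at hp hm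
  apply eq_zero_of_add_self h2
  linear_combination (norm := abel) hp - hm

/-- The cyclic identity, which moves factors from one argument to another one. -/
theorem VanishesOnSquares.map_mul_add (h2 : (2 : F) ≠ 0) {φ : A [⋀^Fin (n + 2)]→ₗ[F] A}
    (h : VanishesOnSquares φ) (x y z : A) (w : Fin n → A) :
    φ (Fin.cons (x * y + y * x) (Fin.cons z w)) = φ (Fin.cons x (Fin.cons (y * z + z * y) w))
      + φ (Fin.cons y (Fin.cons (x * z + z * x) w)) := by
  have key : ∀ x, φ (Fin.cons (x * z + z * x) (Fin.cons x w))
      + φ (Fin.cons (x * x) (Fin.cons z w)) = 0 := fun x => h.map_sq_add h2 x z w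
  -- Polarization in x makes the cyclic sum of φ(x∘y, z, …) zero; swapping two arguments gives the
  -- signs of the claim.
  have hxy := key (x + y)
  have hx := key x
  have hy := key y
  have e1 : (x + y) * z + z * (x + y) = (x * z + z * x) + (y * z + z * y) := by
    simp only [add_mul, mul_add]; abel
  have e2 : (x + y) * (x + y) = x * x + (x * y + y * x) + y * y := by
    simp only [add_mul, mul_add]; abel
  rw [e1, e2] at hxy
  simp only [map_cons_cons_add, map_cons_add φ (x * z + _), map_cons_add φ (x * x + _),
    map_cons_add φ (x * x)] at hxy
  rw [map_cons_cons_swap φ x, map_cons_cons_swap φ y]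
  linear_combination (norm := abel) hxy - hx - hy

/-- The pairs are sorted by whether they involve both, one or neither of the first two arguments.
The last sum stays in terms of products, because all that matters there is that a and b survive as
arguments. -/
theorem skewAlt_succ_cons_cons (k : ℕ) (a b : A) (w : Fin (k + 1) → A) :
    skewAlt F A (k + 2) (Fin.cons a (Fin.cons b w)) =
      skewAlt F A (k + 1) (Fin.cons (a * b - b * a) w) +
      ∑ j : Fin (k + 1), (-1 : ℤ) ^ (j : ℕ) •
        (skewAlt F A (k + 1) (Fin.cons (b * w j - w j * b) (Fin.cons a (j.removeNth w)))
        - skewAlt F A (k + 1) (Fin.cons (a * w j - w j * a) (Fin.cons b (j.removeNth w)))) +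
      ∑ i : Fin (k + 1), ∑ j : Fin k, (-1 : ℤ) ^ ((i : ℕ) + (j : ℕ)) •
        skewAlt F A (k + 1) (Fin.cons (w i * i.removeNth w j)
          (j.succ.succ.removeNth (Fin.cons a (Fin.cons b (i.removeNth w)) : Fin (k + 2) → A))) := by
  have h1 : (Fin.succ 0 : Fin (k + 3)).removeNth (Fin.cons a (Fin.cons b w) : Fin (k + 3) → A) =
      Fin.cons a w := by
    funext i; refine Fin.cases ?_ (fun i => ?_) i <;> simp [Fin.removeNth]
  have h2 : ∀ i : Fin (k + 1), i.succ.succ.removeNth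
      (Fin.cons a (Fin.cons b w) : Fin (k + 3) → A) = Fin.cons a (Fin.cons b (i.removeNth w)) := by
    intro i
    funext j
    refine Fin.cases ?_ (fun j => Fin.cases ?_ (fun j => ?_) j) j <;> simp [Fin.removeNth]
  have h3 : ∀ (c : A) (u : Fin (k + 1) → A) (i : Fin (k + 1)), i.succ.removeNth
      (Fin.cons c u : Fin (k + 2) → A) = Fin.cons c (i.removeNth u) := by
    intro c u i
    funext j
    refine Fin.cases ?_ (fun j => ?_) j <;> simp [Fin.removeNth]
  have h4 : ∀ (c : A) (u : Fin (k + 1) → A), (0 : Fin (k + 2)).removeNth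
      (Fin.cons c u : Fin (k + 2) → A) = u := fun c u => by simp
  have h5 : ∀ (c d : A) (u : Fin k → A), (Fin.succ 0 : Fin (k + 2)).removeNth
      (Fin.cons c (Fin.cons d u) : Fin (k + 2) → A) = Fin.cons c u := by
    intro c d u
    funext i; refine Fin.cases ?_ (fun i => ?_) i <;> simp [Fin.removeNth]
  have inner : ∀ c d : A, ∑ j : Fin (k + 2), (-1) ^ (j : ℕ) • skewAlt F A (k + 1)
      (Fin.cons (c * (Fin.cons d w : Fin (k + 2) → A) j)
        (j.removeNth (Fin.cons d w : Fin (k + 2) → A))) =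
      skewAlt F A (k + 1) (Fin.cons (c * d) w) - ∑ j : Fin (k + 1), (-1 : ℤ) ^ (j : ℕ) •
        skewAlt F A (k + 1) (Fin.cons (c * w j) (Fin.cons d (j.removeNth w))) := by
    intro c d
    rw [Fin.sum_univ_succ]
    simp only [h3, h4, Fin.cons_zero, Fin.cons_succ, Fin.val_zero, Fin.val_succ, pow_succ,
      mul_neg, mul_one, neg_smul, pow_zero, one_smul, Finset.sum_neg_distrib]
    rw [sub_eq_add_neg]
  have inner2 : ∀ i : Fin (k + 1), ∑ j : Fin (k + 2), (-1) ^ (j : ℕ) • skewAlt F A (k + 1)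
      (Fin.cons (w i * (Fin.cons a (Fin.cons b (i.removeNth w)) : Fin (k + 2) → A) j)
        (j.removeNth (Fin.cons a (Fin.cons b (i.removeNth w)) : Fin (k + 2) → A))) =
      skewAlt F A (k + 1) (Fin.cons (w i * a) (Fin.cons b (i.removeNth w))) -
      skewAlt F A (k + 1) (Fin.cons (w i * b) (Fin.cons a (i.removeNth w))) +
      ∑ j : Fin k, (-1 : ℤ) ^ (j : ℕ) •
        skewAlt F A (k + 1) (Fin.cons (w i * i.removeNth w j)
          (j.succ.succ.removeNth (Fin.cons a (Fin.cons b (i.removeNth w)) : Fin (k + 2) → A))) := by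
    intro i
    rw [Fin.sum_univ_succ, Fin.sum_univ_succ]
    simp only [h4, h5, Fin.cons_zero, Fin.cons_succ, Fin.val_zero, Fin.val_succ, pow_succ,
      mul_neg, mul_one, neg_neg, neg_smul, pow_zero, one_smul]
    abel
  have hstep : ∀ f : Fin (k + 3) → A, ∑ i, f i =
      f 0 + f (Fin.succ 0) + ∑ i : Fin (k + 1), f i.succ.succ := fun f => by
    rw [Fin.sum_univ_succ, Fin.sum_univ_succ]
    exact (add_assoc _ _ _).symm
  rw [skewAlt_succ_apply, hstep, h1]
  have h0 : (0 : Fin (k + 3)).removeNth (Fin.cons a (Fin.cons b w) : Fin (k + 3) → A) =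
      Fin.cons b w := by simp
  rw [h0]
  simp only [h2, Fin.cons_zero, Fin.cons_succ, inner, inner2, Fin.val_zero, Fin.val_succ, pow_succ,
      mul_neg, mul_one, neg_neg, neg_smul, pow_zero, one_smul, pow_add, mul_smul,
      map_cons_sub, smul_sub, smul_add, Finset.sum_add_distrib, Finset.sum_sub_distrib,
      Finset.smul_sum, Finset.sum_neg_distrib]
  abel

/-- Induction on the expansion at (x², x, w): [x², x] = 0 by flexibility, pairs inside w keep x² and
x as arguments, and the mixed pairs cancel for each j because [x², w_j] = x∘[x, w_j]. -/
theorem skewAlt_vanishesOnSquares (h2 : (2 : F) ≠ 0) (hA : IsFlexible A) :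
    ∀ k : ℕ, VanishesOnSquares (skewAlt F A (k + 1))
  | 0 => by
      refine vanishesOnSquares_of_zero_one _ fun x w => ?_
      have := hA x x
      rw [associator] at this
      rw [skewAlt_succ_apply']
      simp [skewAlt, this]
  | (k + 1) => by
      have ih := skewAlt_vanishesOnSquares h2 hA k
      refine vanishesOnSquares_of_zero_one _ fun x w => ?_
      have hx : x * x * x - x * (x * x) = 0 := hA x x
      rw [skewAlt_succ_cons_cons, hx]
      have h0 : skewAlt F A (k + 1) (Fin.cons 0 w) = 0 :=
        AlternatingMap.map_coord_zero _ (0 : Fin (k + 2)) (by simp)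
      rw [h0, zero_add, Finset.sum_eq_zero, Finset.sum_eq_zero, add_zero]
      · intro i _
        refine Finset.sum_eq_zero fun j _ => ?_
        obtain ⟨l, rfl⟩ : ∃ l, k = l + 1 := ⟨k - 1, by have := j.2; omega⟩
        rw [ih _ (Fin.succ 0) (Fin.succ (Fin.succ 0)) 
          (fun h => Fin.succ_ne_zero _ (Fin.succ_injective _ h).symm) (by rfl), smul_zero]
      · intro j _
        -- The linearized identity `map_sq_add` is used with y = [x, w_j].
        rw [hA.commutator_sq, map_cons_cons_swap, ← neg_add',
          add_comm (skewAlt F A (k + 1) _), ih.map_sq_add h2, neg_zero, smul_zero]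

end Cyclic

/-! ### Alternating maps when ∘ has few generators -/

section Bounded

variable {F : Type*} [Field F] {A : Type*} [NonUnitalNonAssocRing A] [Module F A]
  [IsScalarTower F A A] [SMulCommClass F A A] {n : ℕ}

theorem VanishesOnSquares.map_update (h2 : (2 : F) ≠ 0) {φ : A [⋀^Fin (n + 2)]→ₗ[F] A}
    (h : VanishesOnSquares φ) (v : Fin (n + 2) → A) {p q : Fin (n + 2)} (hpq : p ≠ q) (x y : A) :
    φ (Function.update v p (x * y + y * x)) =
      φ (Function.update (Function.update v p x) q (y * v q + v q * y)) +
      φ (Function.update (Function.update v p y) q (x * v q + v q * x)) := by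
  obtain ⟨σ, h0, h1⟩ := exists_perm_zero_one hpq
  have key : ∀ a b : A, (Function.update (Function.update v p a) q b) ∘ σ =
      Fin.cons a (Fin.cons b fun i => v (σ i.succ.succ)) := by
    intro a b
    funext i
    refine Fin.cases ?_ (fun i => Fin.cases ?_ (fun i => ?_) i) i
    · simp [h0, hpq]
    · simp [h1]
    · have hp' : σ i.succ.succ ≠ p := fun e => by
        rw [← h0] at e
        exact Fin.succ_ne_zero _ (σ.injective e)
      have hq' : σ i.succ.succ ≠ q := fun e => by
        rw [← h1] at e
        have := σ.injective e
        rw [← Fin.succ_zero_eq_one] at this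
        exact Fin.succ_ne_zero _ (Fin.succ_injective _ this)
      simp [hp', hq']
  have key' : ∀ a : A, Function.update v p a = Function.update (Function.update v p a) q (v q) := by
    intro a
    rw [Function.update_comm hpq, Function.update_eq_self]
  rw [key']
  have hφ : ∀ u, φ u = Equiv.Perm.sign σ • φ (u ∘ σ) := fun u => by
    rw [φ.map_perm, smul_smul, Int.units_mul_self, one_smul]
  rw [hφ, hφ (Function.update (Function.update v p x) q _),
    hφ (Function.update (Function.update v p y) q _), key, key, key, ← smul_add,
    h.map_mul_add h2]

/-- If `A` is generated by a finite set `V` with respect to the product `x * y + y * x`, then an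
alternating map which vanishes on squares and has enough arguments is zero. -/
theorem VanishesOnSquares.eq_zero (h2 : (2 : F) ≠ 0) {φ : A [⋀^Fin (n + 2)]→ₗ[F] A}
    (h : VanishesOnSquares φ) (V : Finset A) (hcard : V.card ≤ n)
    (hV : ∀ S : Submodule F A, (∀ a ∈ V, a ∈ S) → (∀ a ∈ S, ∀ b ∈ S, a * b + b * a ∈ S) → S = ⊤)
    (v : Fin (n + 2) → A) : φ v = 0 := by
  -- Here s is a set of positions already filled from V, and k counts the others.
  suffices H : ∀ (k : ℕ) (s : Finset (Fin (n + 2))), n + 2 - s.card = k →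
      ∀ v : Fin (n + 2) → A, (∀ i ∈ s, v i ∈ V) → φ v = 0 from
    H _ ∅ rfl v (by simp)
  intro k
  induction k with
  | zero =>
    intro s hs v hv
    obtain ⟨i, hi, j, hj, hij, hvij⟩ := Finset.exists_ne_map_eq_of_card_lt_of_maps_to
      (by omega : V.card < s.card) hv
    exact φ.map_eq_zero_of_eq v hvij hij
  | succ k ih =>
    intro s hs v hv
    by_cases hlarge : n < s.card
    · obtain ⟨i, hi, j, hj, hij, hvij⟩ := Finset.exists_ne_map_eq_of_card_lt_of_maps_to
        (by omega : V.card < s.card) hv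
      exact φ.map_eq_zero_of_eq v hvij hij
    · have hc : 1 < sᶜ.card := by
        rw [Finset.card_compl, Fintype.card_fin]; omega
      obtain ⟨p, hp, q, hq, hpq⟩ := Finset.one_lt_card.1 hc
      rw [Finset.mem_compl] at hp hq
      -- While at most n positions are filled, two free ones p and q remain. S collects the values
      -- at p that force zero whatever stands at the free positions; this freedom lets q absorb the
      -- factor moved by the cyclic identity, so S is closed under ∘.
      let S : Submodule F A :=
        { carrier := {a | ∀ v : Fin (n + 2) → A, (∀ i ∈ s, v i ∈ V) →
            φ (Function.update v p a) = 0}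
          add_mem' := fun ha hb v hv => by
            rw [φ.map_update_add, ha v hv, hb v hv, add_zero]
          zero_mem' := fun v hv => φ.map_update_zero v p
          smul_mem' := fun c a ha v hv => by
            rw [φ.map_update_smul, ha v hv, smul_zero] }
      have hS : S = ⊤ := by
        refine hV S (fun a ha v hv => ?_) (fun a ha b hb v hv => ?_)
        · refine ih (insert p s) (by rw [Finset.card_insert_of_notMem hp]; omega) _ fun i hi => ?_
          rcases Finset.mem_insert.1 hi with rfl | hi
          · simpa using ha
          · rw [Function.update_of_ne (fun e : i = p => hp (e ▸ hi))]
            exact hv i hi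
        · have hu : ∀ c : A, ∀ i ∈ s, Function.update v q c i ∈ V := fun c i hi => by
            rw [Function.update_of_ne (fun e : i = q => hq (e ▸ hi))]
            exact hv i hi
          rw [h.map_update h2 v hpq, Function.update_comm hpq, ha _ (hu _),
            Function.update_comm hpq, hb _ (hu _), add_zero]
      have hmem : v p ∈ S := hS ▸ Submodule.mem_top
      have := hmem v hv
      rwa [Function.update_eq_self] at this

end Bounded

/-! ### The ideal spanned by the squares -/

section Quotient

variable {F : Type u} [Field F] {A : Type u} [NonUnitalNonAssocRing A] [Module F A]
  [IsScalarTower F A A] [SMulCommClass F A A]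

theorem exists_quotient (J : Submodule F A) (hl : ∀ a, ∀ x ∈ J, a * x ∈ J)
    (hr : ∀ a, ∀ x ∈ J, x * a ∈ J) :
    ∃ (B : Type u) (_ : NonUnitalNonAssocRing B) (_ : Module F B) (_ : IsScalarTower F B B)
      (_ : SMulCommClass F B B) (π : A →ₙₐ[F] B), Function.Surjective π ∧
        ∀ a, π a = 0 ↔ a ∈ J := by
  let c : RingCon A :=
    { r := fun a b => a - b ∈ J
      iseqv :=
        { refl := fun a => by simp
          symm := fun {a b} h => by simpa using J.neg_mem h
          trans := fun {a b c} h h' => by simpa using J.add_mem h h' }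
      add' := fun {a b c d} h h' => by
        have := J.add_mem h h'
        rwa [← add_sub_add_comm] at this
      mul' := fun {a b c d} h h' => by
        have := J.add_mem (hr c _ h) (hl b _ h')
        rwa [sub_mul, mul_sub, sub_add_sub_cancel] at this }
  let mk : A →ₙ+* c.Quotient :=
    { toFun := fun a => (a : c.Quotient)
      map_mul' := fun _ _ => rfl
      map_zero' := rfl
      map_add' := fun _ _ => rfl }
  have hmk : Function.Surjective mk := fun a => Quotient.inductionOn' a fun b => ⟨b, rfl⟩
  let _ : SMul F c.Quotient :=
    ⟨fun t => Quotient.map' (fun a => t • a) fun a b (h : a - b ∈ J) => by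
      show t • a - t • b ∈ J
      rw [← smul_sub]
      exact J.smul_mem t h⟩
  have hsmul : ∀ (t : F) (a : A), mk (t • a) = t • mk a := fun _ _ => rfl
  let _ : Module F c.Quotient := hmk.module F mk.toAddMonoidHom hsmul
  refine ⟨c.Quotient, inferInstance, inferInstance, ⟨fun t a b => ?_⟩, ⟨fun t a b => ?_⟩,
    { toFun := mk
      map_smul' := hsmul
      map_zero' := map_zero mk
      map_add' := map_add mk
      map_mul' := map_mul mk }, hmk, fun a => ?_⟩
  · obtain ⟨a, rfl⟩ := hmk a
    obtain ⟨b, rfl⟩ := hmk b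
    simp only [smul_eq_mul, ← hsmul, ← map_mul, smul_mul_assoc]
  · obtain ⟨a, rfl⟩ := hmk a
    obtain ⟨b, rfl⟩ := hmk b
    simp only [smul_eq_mul, ← hsmul, ← map_mul, mul_smul_comm]
  · refine (RingCon.eq c).trans ?_
    show a - 0 ∈ J ↔ a ∈ J
    rw [sub_zero]

variable (F A)

/-- The span of the squares. -/
def squareSpan : Submodule F A := Submodule.span F (Set.range fun x : A => x * x)

variable {F A}

theorem sq_mem_squareSpan (x : A) : x * x ∈ squareSpan F A := Submodule.subset_span ⟨x, rfl⟩

theorem mul_add_mul_mem_squareSpan (x y : A) : x * y + y * x ∈ squareSpan F A := by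
  have e : x * y + y * x = (x + y) * (x + y) - x * x - y * y := by
    simp only [add_mul, mul_add]; abel
  rw [e]
  exact sub_mem (sub_mem (sq_mem_squareSpan _) (sq_mem_squareSpan _)) (sq_mem_squareSpan _)

/-- Both x²∘a and [x², a] = x∘[x, a] lie in the span; half their sum and difference are x²a and ax².
-/
theorem IsFlexible.mul_mem_squareSpan (h2 : (2 : F) ≠ 0) (hA : IsFlexible A) (a x : A)
    (hx : x ∈ squareSpan F A) : a * x ∈ squareSpan F A ∧ x * a ∈ squareSpan F A := by
  induction hx using Submodule.span_induction with
  | mem y hy =>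
    obtain ⟨x, rfl⟩ := hy
    have h1 : x * x * a + a * (x * x) ∈ squareSpan F A := mul_add_mul_mem_squareSpan _ _
    have h3 : x * x * a - a * (x * x) ∈ squareSpan F A := by
      rw [hA.commutator_sq]
      exact mul_add_mul_mem_squareSpan _ _
    have half : ∀ z : A, z + z ∈ squareSpan F A → z ∈ squareSpan F A := fun z hz => by
      rw [← two_smul F] at hz
      exact (Submodule.smul_mem_iff _ h2).1 hz
    constructor
    · apply half
      have := sub_mem h1 h3
      convert this using 1
      abel
    · apply half
      have := add_mem h1 h3
      convert this using 1
      abel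
  | zero => simp
  | add x y _ _ hx hy =>
    rw [mul_add, add_mul]
    exact ⟨add_mem hx.1 hy.1, add_mem hx.2 hy.2⟩
  | smul c x _ hx =>
    rw [mul_smul_comm, smul_mul_assoc]
    exact ⟨Submodule.smul_mem _ c hx.1, Submodule.smul_mem _ c hx.2⟩

theorem InVariety.of_surjective {I : Set (FreeNonUnitalNonAssocAlgebra F ℕ)}
    {B : Type u} [NonUnitalNonAssocRing B] [Module F B] [IsScalarTower F B B]
    [SMulCommClass F B B] (π : A →ₙₐ[F] B) (hπ : Function.Surjective π) (h : InVariety I A) :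
    InVariety I B := by
  intro g hg φ
  choose s hs using fun i => hπ (φ i)
  have : FreeNonUnitalNonAssocAlgebra.lift F φ =
      π.comp (FreeNonUnitalNonAssocAlgebra.lift F s) := by
    refine FreeNonUnitalNonAssocAlgebra.hom_ext F fun i => ?_
    rw [NonUnitalAlgHom.comp_apply, FreeNonUnitalNonAssocAlgebra.lift_of_apply,
      FreeNonUnitalNonAssocAlgebra.lift_of_apply, hs]
  rw [this, NonUnitalAlgHom.comp_apply, h hg s, map_zero]

theorem IsGeneratedBy.of_surjective {B : Type u} [NonUnitalNonAssocRing B] [Module F B]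
    [IsScalarTower F B B] [SMulCommClass F B B] (π : A →ₙₐ[F] B) (hπ : Function.Surjective π)
    {m : ℕ} (h : IsGeneratedBy F A m) : IsGeneratedBy F B m := by
  obtain ⟨x, hx⟩ := h
  refine ⟨π ∘ x, ?_⟩
  rw [Set.range_comp, ← NonUnitalAlgHom.map_adjoin, hx, eq_top_iff]
  intro b _
  obtain ⟨a, rfl⟩ := hπ b
  exact ⟨a, trivial, rfl⟩

end Quotient

/-! ### Relatively free algebras -/

section Free

variable {F : Type u} [Field F] (I : Set (FreeNonUnitalNonAssocAlgebra F ℕ)) (X : Type)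

/-- The canonical projection, as a homomorphism of algebras. -/
noncomputable def RelFree.mkHom : FreeNonUnitalNonAssocAlgebra F X →ₙₐ[F] RelFree I X :=
  { RelFree.mk I X with map_smul' := RelFree.mk_smul I X }

variable {I X}

theorem RelFree.mkHom_apply (a : FreeNonUnitalNonAssocAlgebra F X) :
    RelFree.mkHom I X a = RelFree.mk I X a := rfl

theorem RelFree.mk_eq_zero_iff {a : FreeNonUnitalNonAssocAlgebra F X} :
    RelFree.mk I X a = 0 ↔ ∀ (A : Type u) [NonUnitalNonAssocRing A] [Module F A]
      [IsScalarTower F A A] [SMulCommClass F A A], InVariety I A → ∀ φ : X → A,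
        FreeNonUnitalNonAssocAlgebra.lift F φ a = 0 := by
  refine (RingCon.eq (relFreeCon I X) (a := a) (b := 0)).trans ?_
  refine forall_congr' fun A => forall_congr' fun _ => forall_congr' fun _ =>
    forall_congr' fun _ => forall_congr' fun _ => forall_congr' fun _ => forall_congr' fun φ => ?_
  rw [map_zero]

theorem lift_comp_lift {Y : Type} {A : Type u} [NonUnitalNonAssocRing A] [Module F A]
    [IsScalarTower F A A] [SMulCommClass F A A] {B : Type u} [NonUnitalNonAssocRing B] [Module F B]
    [IsScalarTower F B B] [SMulCommClass F B B] (f : A →ₙₐ[F] B) (ψ : Y → A)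
    (a : FreeNonUnitalNonAssocAlgebra F Y) :
    f (FreeNonUnitalNonAssocAlgebra.lift F ψ a) =
      FreeNonUnitalNonAssocAlgebra.lift F (fun y => f (ψ y)) a := by
  have : f.comp (FreeNonUnitalNonAssocAlgebra.lift F ψ) =
      FreeNonUnitalNonAssocAlgebra.lift F (fun y => f (ψ y)) := by
    refine FreeNonUnitalNonAssocAlgebra.hom_ext F fun i => ?_
    rw [NonUnitalAlgHom.comp_apply, FreeNonUnitalNonAssocAlgebra.lift_of_apply,
      FreeNonUnitalNonAssocAlgebra.lift_of_apply]
  exact congrArg (fun g => g a) this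

variable (I X)

theorem RelFree.inVariety : InVariety I (RelFree I X) := by
  intro g hg φ
  choose ψ hψ using fun i => RelFree.mk_surjective I X (φ i)
  obtain rfl : φ = fun i => RelFree.mkHom I X (ψ i) := funext fun i => (hψ i).symm
  rw [← lift_comp_lift, RelFree.mkHom_apply, RelFree.mk_eq_zero_iff]
  intro A _ _ _ _ hA χ
  rw [lift_comp_lift]
  exact hA hg _

theorem lift_single {Y A : Type*} [NonUnitalNonAssocRing A] [Module F A]
    [IsScalarTower F A A] [SMulCommClass F A A] (φ : Y → A) (w : FreeMagma Y) (r : F) :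
    FreeNonUnitalNonAssocAlgebra.lift F φ (MonoidAlgebra.single w r) =
      r • FreeMagma.lift φ w := by
  simp [FreeNonUnitalNonAssocAlgebra.lift, MonoidAlgebra.liftMagma_apply_apply]

theorem lift_mem_adjoin {Y A : Type*} [NonUnitalNonAssocRing A] [Module F A]
    [IsScalarTower F A A] [SMulCommClass F A A] (φ : Y → A)
    (a : FreeNonUnitalNonAssocAlgebra F Y) :
    FreeNonUnitalNonAssocAlgebra.lift F φ a ∈ NonUnitalAlgebra.adjoin F (Set.range φ) := by
  induction a using MonoidAlgebra.induction_linear with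
  | zero => rw [map_zero]; exact zero_mem _
  | add a b ha hb => rw [map_add]; exact add_mem ha hb
  | single w r =>
    rw [lift_single]
    refine SMulMemClass.smul_mem r ?_
    induction w with
    | ih1 x => exact NonUnitalAlgebra.subset_adjoin F ⟨x, rfl⟩
    | ih2 x y hx hy => rw [map_mul]; exact mul_mem hx hy

theorem RelFree.lift_gen (a : FreeNonUnitalNonAssocAlgebra F X) :
    FreeNonUnitalNonAssocAlgebra.lift F (RelFree.gen I X) a = RelFree.mk I X a := by
  have : FreeNonUnitalNonAssocAlgebra.lift F (RelFree.gen I X) = RelFree.mkHom I X :=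
    FreeNonUnitalNonAssocAlgebra.hom_ext F fun i => by
      rw [FreeNonUnitalNonAssocAlgebra.lift_of_apply]; rfl
  rw [this, RelFree.mkHom_apply]

theorem RelFree.isGeneratedBy (m : ℕ) : IsGeneratedBy F (RelFree I (Fin m)) m := by
  refine ⟨RelFree.gen I (Fin m), eq_top_iff.2 fun a _ => ?_⟩
  obtain ⟨a, rfl⟩ := RelFree.mk_surjective I _ a
  rw [← RelFree.lift_gen]
  exact lift_mem_adjoin _ a

end Free

/-! ### Grading by degree -/

section Homogeneous

variable {F : Type u} [Field F] {I : Set (FreeNonUnitalNonAssocAlgebra F ℕ)} {X : Type}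

open Classical in
/-- The homogeneous component of degree `d` for an arbitrary set of variables, as a linear map. -/
noncomputable def component (F : Type u) [Field F] (X : Type) (d : ℕ) :
    FreeNonUnitalNonAssocAlgebra F X →ₗ[F] FreeNonUnitalNonAssocAlgebra F X where
  toFun a := .ofCoeff (a.coeff.filter fun w => w.length = d)
  map_add' a b := by simp [Finsupp.filter_add]
  map_smul' c a := by simp [Finsupp.filter_smul]

theorem component_eq (d : ℕ) (a : FreeNonUnitalNonAssocAlgebra F ℕ) :
    component F ℕ d a = homogeneousComponent d a := rfl

theorem component_single (d : ℕ) (w : FreeMagma X) (r : F) :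
    component F X d (MonoidAlgebra.single w r) =
      if w.length = d then MonoidAlgebra.single w r else 0 := by
  classical
  split_ifs with h
  · exact congrArg MonoidAlgebra.ofCoeff (Finsupp.filter_single_of_pos _ h)
  · exact congrArg MonoidAlgebra.ofCoeff (Finsupp.filter_single_of_neg _ h)

theorem lift_smul_word {A : Type*} [NonUnitalNonAssocRing A] [Module F A]
    [IsScalarTower F A A] [SMulCommClass F A A] (t : F) (φ : X → A) (w : FreeMagma X) :
    FreeMagma.lift (fun x => t • φ x) w = t ^ w.length • FreeMagma.lift φ w := by
  induction w with
  | ih1 x => simp [FreeMagma.length]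
  | ih2 x y hx hy =>
    rw [map_mul, map_mul, hx, hy, smul_mul_smul_comm, ← pow_add]
    rfl

/-- Over an infinite field every variety is homogeneous. -/
theorem isHomogeneousVariety_of_infinite [Infinite F]
    (I : Set (FreeNonUnitalNonAssocAlgebra F ℕ)) : IsHomogeneousVariety I := by
  intro a ha d
  rw [RelFree.mk_eq_zero_iff] at ha ⊢
  intro A _ _ _ _ hA φ
  rw [← Module.forall_dual_apply_eq_zero_iff F]
  intro l
  -- Scaling all variables by t gives, after applying a functional, a polynomial in t whose
  -- coefficient at t^d is the degree d component. For an identity it vanishes at every t, hence is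
  -- zero over an infinite field.
  have key : ∀ b : FreeNonUnitalNonAssocAlgebra F ℕ, ∃ P : Polynomial F,
      (∀ t : F, P.eval t = l (FreeNonUnitalNonAssocAlgebra.lift F (fun x => t • φ x) b)) ∧
      P.coeff d = l (FreeNonUnitalNonAssocAlgebra.lift F φ (component F ℕ d b)) := by
    intro b
    induction b using MonoidAlgebra.induction_linear with
    | zero => exact ⟨0, by simp, by simp⟩
    | add a b ha hb =>
      obtain ⟨P, hP, hP'⟩ := ha
      obtain ⟨Q, hQ, hQ'⟩ := hb
      exact ⟨P + Q, fun t => by rw [Polynomial.eval_add, hP, hQ, map_add, map_add],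
        by rw [Polynomial.coeff_add, hP', hQ', map_add, map_add, map_add]⟩
    | single w r =>
      refine ⟨Polynomial.C (r * l (FreeMagma.lift φ w)) * Polynomial.X ^ w.length,
        fun t => ?_, ?_⟩
      · rw [lift_single, lift_smul_word]
        simp only [Polynomial.eval_mul, Polynomial.eval_C, Polynomial.eval_pow, Polynomial.eval_X,
          map_smul, smul_eq_mul]
        ring
      · rw [component_single, Polynomial.coeff_C_mul_X_pow]
        by_cases h : w.length = d
        · rw [if_pos h, if_pos h.symm, lift_single, map_smul, smul_eq_mul]
        · rw [if_neg h, if_neg (Ne.symm h), map_zero, map_zero]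
  obtain ⟨P, hP, hP'⟩ := key a
  have hP0 : P = 0 := Polynomial.funext fun t => by rw [hP, ha A hA]; simp
  rw [← component_eq, ← hP', hP0, Polynomial.coeff_zero]

theorem length_map {Y : Type} (f : X → Y) (w : FreeMagma X) :
    (FreeMagma.lift (fun x => FreeMagma.of (f x)) w).length = w.length := by
  induction w with
  | ih1 x => rfl
  | ih2 x y hx hy =>
    rw [map_mul]
    exact congrArg₂ (· + ·) hx hy

theorem lift_of_word {Y : Type} (f : X → Y) (w : FreeMagma X) :
    FreeMagma.lift (fun x => FreeNonUnitalNonAssocAlgebra.of F (f x)) w =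
      MonoidAlgebra.single (FreeMagma.lift (fun x => FreeMagma.of (f x)) w) 1 := by
  induction w with
  | ih1 x => rfl
  | ih2 x y hx hy => rw [map_mul, map_mul, hx, hy, MonoidAlgebra.single_mul_single, one_mul]

theorem component_rename {Y : Type} (f : X → Y) (d : ℕ) (a : FreeNonUnitalNonAssocAlgebra F X) :
    component F Y d (FreeNonUnitalNonAssocAlgebra.lift F
      (fun x => FreeNonUnitalNonAssocAlgebra.of F (f x)) a) =
    FreeNonUnitalNonAssocAlgebra.lift F
      (fun x => FreeNonUnitalNonAssocAlgebra.of F (f x)) (component F X d a) := by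
  induction a using MonoidAlgebra.induction_linear with
  | zero => simp
  | add a b ha hb => simp only [map_add, ha, hb]
  | single w r =>
    rw [lift_single, map_smul, lift_of_word, component_single, component_single, length_map]
    split_ifs
    · rw [lift_single, lift_of_word]
    · simp

/-- Homogeneity speaks of countably many variables; renaming preserves degrees and transfers it to
finitely many. -/
theorem IsHomogeneousVariety.mk_component_eq_zero (h : IsHomogeneousVariety I) {m : ℕ}
    {a : FreeNonUnitalNonAssocAlgebra F (Fin m)} (ha : RelFree.mk I (Fin m) a = 0) (d : ℕ) :
    RelFree.mk I (Fin m) (component F (Fin m) d a) = 0 := by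
  have h1 : RelFree.mk I ℕ (FreeNonUnitalNonAssocAlgebra.lift F
      (fun i : Fin m => FreeNonUnitalNonAssocAlgebra.of F (i : ℕ)) a) = 0 := by
    rw [RelFree.mk_eq_zero_iff] at ha ⊢
    intro A _ _ _ _ hA φ
    rw [lift_comp_lift]
    exact ha A hA _
  have h2 := h _ h1 d
  rw [← component_eq, component_rename] at h2
  rw [RelFree.mk_eq_zero_iff] at h2 ⊢
  intro A _ _ _ _ hA φ
  have h3 := h2 A hA fun i => if h : i < m then φ ⟨i, h⟩ else 0
  rw [lift_comp_lift] at h3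
  convert h3 using 4
  simp

variable (F X) in
/-- The span of the elements `u * v + v * u` of degree `d`, where `u` and `v` are words. -/
noncomputable def jordanSpan (d : ℕ) : Submodule F (FreeNonUnitalNonAssocAlgebra F X) :=
  Submodule.span F
      {z : FreeNonUnitalNonAssocAlgebra F X | ∃ u v : FreeMagma X, u.length + v.length = d ∧
        z = MonoidAlgebra.single (u * v) 1 + MonoidAlgebra.single (v * u) 1}

/-- The homogeneous components of a combination of squares are combinations of elements
`u * v + v * u`. -/
theorem component_mem_span (d : ℕ) {g : FreeNonUnitalNonAssocAlgebra F X}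
    (hg : g ∈ squareSpan F (FreeNonUnitalNonAssocAlgebra F X)) (h2 : (2 : F) ≠ 0) :
    component F X d g ∈ jordanSpan F X d := by
  have key : ∀ a b : FreeNonUnitalNonAssocAlgebra F X, component F X d (a * b + b * a) ∈
      jordanSpan F X d := by
    intro a b
    induction a using MonoidAlgebra.induction_linear with
    | zero => simp
    | add a a' ha ha' =>
      have := add_mem ha ha'
      rw [← map_add] at this
      convert this using 2
      simp only [add_mul, mul_add]; abel
    | single u r =>
      induction b using MonoidAlgebra.induction_linear with
      | zero => simp
      | add a a' ha ha' =>
        have := add_mem ha ha'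
        rw [← map_add] at this
        convert this using 2
        simp only [add_mul, mul_add]; abel
      | single v s =>
        rw [MonoidAlgebra.single_mul_single, MonoidAlgebra.single_mul_single, map_add,
          component_single, component_single]
        have e1 : (u * v).length = u.length + v.length := rfl
        have e2 : (v * u).length = u.length + v.length := add_comm _ _
        rw [e1, e2]
        split_ifs with h
        · have : (MonoidAlgebra.single (u * v) (r * s) + MonoidAlgebra.single (v * u) (s * r) :
              FreeNonUnitalNonAssocAlgebra F X) = (r * s) •
              (MonoidAlgebra.single (u * v) 1 + MonoidAlgebra.single (v * u) 1) := by
            simp [mul_comm s r]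
          rw [this]
          exact Submodule.smul_mem _ _ (Submodule.subset_span ⟨u, v, h, rfl⟩)
        · simp
  suffices H : squareSpan F (FreeNonUnitalNonAssocAlgebra F X) ≤
      Submodule.comap (component F X d) (jordanSpan F X d) from H hg
  refine Submodule.span_le.2 ?_
  rintro _ ⟨x, rfl⟩
  show component F X d (x * x) ∈ jordanSpan F X d
  -- This is twice the component of x².
  have := key x x
  rw [map_add, ← two_smul F] at this
  exact (Submodule.smul_mem_iff _ h2).1 this

end Homogeneous

/-! ### The bound N(m) and the basic rank -/

section Main

variable {F : Type u} [Field F] {I : Set (FreeNonUnitalNonAssocAlgebra F ℕ)}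

theorem finite_words (m n : ℕ) : {w : FreeMagma (Fin m) | w.length < n}.Finite := by
  induction n with
  | zero => simp
  | succ n ih =>
    refine ((Set.finite_range FreeMagma.of).union (ih.image2 (fun x y => x * y) ih)).subset ?_
    intro w hw
    cases w with
    | of x => exact Or.inl ⟨x, rfl⟩
    | mul x y =>
      have e : (x * y).length = x.length + y.length := rfl
      have hx := x.length_pos
      have hy := y.length_pos
      have hw : (x * y).length < n + 1 := hw
      exact Or.inr ⟨x, show x.length < n by omega, y, show y.length < n by omega, rfl⟩

/-- Degrees are taken in the absolutely free algebra, so combinations of squares are lifted there.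
-/
theorem mk_mem_squareSpan {m : ℕ} {z : RelFree I (Fin m)}
    (hz : z ∈ squareSpan F (RelFree I (Fin m))) :
    ∃ g ∈ squareSpan F (FreeNonUnitalNonAssocAlgebra F (Fin m)), RelFree.mk I (Fin m) g = z := by
  induction hz using Submodule.span_induction with
  | mem y hy =>
    obtain ⟨x, rfl⟩ := hy
    obtain ⟨a, rfl⟩ := RelFree.mk_surjective I _ x
    exact ⟨a * a, sq_mem_squareSpan a, map_mul _ _ _⟩
  | zero => exact ⟨0, zero_mem _, map_zero _⟩
  | add x y _ _ hx hy =>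
    obtain ⟨g, hg, rfl⟩ := hx
    obtain ⟨g', hg', rfl⟩ := hy
    exact ⟨g + g', add_mem hg hg', map_add _ _ _⟩
  | smul c x _ hx =>
    obtain ⟨g, hg, rfl⟩ := hx
    exact ⟨c • g, Submodule.smul_mem _ c hg, RelFree.mk_smul _ _ _ _⟩

/-- Long words in the generators lie in the span of the squares. -/
theorem exists_word_mem_squareSpan (h2 : (2 : F) ≠ 0) {A : Type u} [NonUnitalNonAssocRing A]
    [Module F A] [IsScalarTower F A A] [SMulCommClass F A A] (hflex : IsFlexible A)
    (hI : InVariety I A)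
    (hnil : ∀ (A : Type u) [NonUnitalNonAssocRing A] [Module F A] [IsScalarTower F A A]
      [SMulCommClass F A A], InVariety I A → IsFinGenerated F A →
        IsAnticommutative A → IsNilpotentAlgebra A)
    {m : ℕ} (hA : IsGeneratedBy F A m) :
    ∃ n : ℕ, ∀ (X : Type) (φ : X → A) (w : FreeMagma X), n ≤ w.length →
      FreeMagma.lift φ w ∈ squareSpan F A := by
  obtain ⟨B, _, _, _, _, π, hπ, hker⟩ := exists_quotient (squareSpan F A)
    (fun a x hx => (hflex.mul_mem_squareSpan h2 a x hx).1)
    (fun a x hx => (hflex.mul_mem_squareSpan h2 a x hx).2)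
  obtain ⟨n, hn⟩ := hnil B (hI.of_surjective π hπ) ⟨m, hA.of_surjective π hπ⟩ (fun x => by
    obtain ⟨a, rfl⟩ := hπ x
    rw [← map_mul, hker]
    exact sq_mem_squareSpan a)
  refine ⟨n, fun X φ w hw => ?_⟩
  rw [← hker]
  -- Nilpotency concerns words in elements of B, so the letters of w are replaced by their images.
  have e1 : ∀ w : FreeMagma X, π (FreeMagma.lift φ w) = FreeMagma.lift (id : B → B)
      (FreeMagma.lift (fun x => FreeMagma.of (π (φ x))) w) := by
    intro w
    induction w with
    | ih1 x => rfl
    | ih2 x y hx hy => rw [map_mul, map_mul, hx, hy, map_mul, map_mul]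
  have e2 : ∀ w : FreeMagma X,
      (FreeMagma.lift (fun x => FreeMagma.of (π (φ x))) w).length = w.length := by
    intro w
    induction w with
    | ih1 x => rfl
    | ih2 x y hx hy =>
      rw [map_mul]
      exact congrArg₂ (· + ·) hx hy
  rw [e1]
  exact hn _ (by rw [e2]; exact hw)

theorem exists_skewPoly_relFree_eq_zero (h2 : (2 : F) ≠ 0)
    (hflex : ∀ (A : Type u) [NonUnitalNonAssocRing A] [Module F A] [IsScalarTower F A A]
      [SMulCommClass F A A], InVariety I A → IsFlexible A)
    (hnil : ∀ (A : Type u) [NonUnitalNonAssocRing A] [Module F A] [IsScalarTower F A A]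
      [SMulCommClass F A A], InVariety I A → IsFinGenerated F A →
        IsAnticommutative A → IsNilpotentAlgebra A)
    (hhom : IsHomogeneousVariety I) (m : ℕ) :
    ∃ N : ℕ, 1 ≤ N ∧ ∀ x : Fin N → RelFree I (Fin m), skewPoly N x = 0 := by
  classical
  have hI : InVariety I (RelFree I (Fin m)) := RelFree.inVariety I _
  have hfl := hflex _ hI
  obtain ⟨n, hn⟩ := exists_word_mem_squareSpan h2 hfl hI hnil (RelFree.isGeneratedBy I m)
  let word : FreeMagma (Fin m) → RelFree I (Fin m) := fun w =>
    RelFree.mk I (Fin m) (MonoidAlgebra.single w 1)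
  have hword : ∀ w, FreeMagma.lift (RelFree.gen I (Fin m)) w = word w := fun w => by
    have := RelFree.lift_gen I (Fin m) (MonoidAlgebra.single w 1)
    rwa [lift_single, one_smul] at this
  have hmul : ∀ u v, word (u * v) = word u * word v := fun u v => by
    rw [← hword, map_mul, hword, hword]
  -- The short words generate under ∘: by induction on the degree d, a longer word equals the degree
  -- d component of a combination of squares, hence a combination of u∘v with u and v of smaller
  -- degree.
  let V : Finset (RelFree I (Fin m)) := (finite_words m n).toFinset.image word
  have hV : ∀ S : Submodule F (RelFree I (Fin m)), (∀ a ∈ V, a ∈ S) →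
      (∀ a ∈ S, ∀ b ∈ S, a * b + b * a ∈ S) → S = ⊤ := by
    intro S hVS hS
    have hw : ∀ (d : ℕ) (w : FreeMagma (Fin m)), w.length = d → word w ∈ S := by
      intro d
      induction d using Nat.strong_induction_on with
      | _ d ih =>
        intro w hwd
        by_cases hlt : w.length < n
        · exact hVS _ (Finset.mem_image_of_mem _ (by simpa using hlt))
        · have h1 := hn _ (RelFree.gen I (Fin m)) w (not_lt.1 hlt)
          rw [hword] at h1
          obtain ⟨g, hg, hgw⟩ := mk_mem_squareSpan h1
          have h3 : RelFree.mk I (Fin m) (MonoidAlgebra.single w 1 - g) = 0 := by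
            rw [map_sub, hgw, sub_self]
          have h4 := hhom.mk_component_eq_zero h3 d
          rw [map_sub, component_single, if_pos hwd, map_sub, sub_eq_zero] at h4
          show RelFree.mk I (Fin m) _ ∈ S
          rw [h4]
          have h5 := component_mem_span d hg h2
          suffices H : jordanSpan F (Fin m) d ≤ Submodule.comap (RelFree.mkHom I (Fin m) :
              FreeNonUnitalNonAssocAlgebra F (Fin m) →ₗ[F] RelFree I (Fin m)) S from H h5
          refine Submodule.span_le.2 ?_
          rintro _ ⟨u, v, huv, rfl⟩
          show RelFree.mk I (Fin m) _ ∈ S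
          rw [map_add]
          have hu := u.length_pos
          have hv := v.length_pos
          have := hS _ (ih u.length (by omega) u rfl) _ (ih v.length (by omega) v rfl)
          rwa [← hmul, ← hmul] at this
    rw [eq_top_iff]
    intro a _
    obtain ⟨a, rfl⟩ := RelFree.mk_surjective I _ a
    induction a using MonoidAlgebra.induction_linear with
    | zero => rw [map_zero]; exact zero_mem _
    | add a b ha hb => rw [map_add]; exact add_mem (ha trivial) (hb trivial)
    | single w r =>
      have e : (MonoidAlgebra.single w r : FreeNonUnitalNonAssocAlgebra F (Fin m)) =
          r • MonoidAlgebra.single w 1 := by simp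
      rw [e, RelFree.mk_smul]
      exact S.smul_mem r (hw _ w rfl)
  refine ⟨V.card + 2, by omega, fun x => ?_⟩
  rw [skewPoly_succ (F := F)]
  exact (skewAlt_vanishesOnSquares h2 hfl V.card).eq_zero h2 V le_rfl hV x

/-- An m-generated algebra of the variety is an image of the free one of rank m. -/
theorem skewPoly_eq_zero_of_relFree {m N : ℕ}
    (h : ∀ x : Fin N → RelFree I (Fin m), skewPoly N x = 0)
    {A : Type u} [NonUnitalNonAssocRing A] [Module F A] [IsScalarTower F A A]
    [SMulCommClass F A A] (hI : InVariety I A) (hA : IsGeneratedBy F A m) (x : Fin N → A) :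
    skewPoly N x = 0 := by
  obtain ⟨y, hy⟩ := hA
  have hsurj : ∀ a : A, ∃ b, FreeNonUnitalNonAssocAlgebra.lift F y b = a := by
    intro a
    have ha : a ∈ NonUnitalAlgebra.adjoin F (Set.range y) := hy ▸ trivial
    have hle : NonUnitalAlgebra.adjoin F (Set.range y) ≤
        NonUnitalAlgHom.range (FreeNonUnitalNonAssocAlgebra.lift F y) := by
      refine NonUnitalAlgebra.adjoin_le ?_
      rintro _ ⟨i, rfl⟩
      exact ⟨_, FreeNonUnitalNonAssocAlgebra.lift_of_apply F y i⟩
    exact hle ha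
  choose s hs using fun i => hsurj (x i)
  have h1 : RelFree.mk I (Fin m) (skewPoly N s) = 0 := by rw [map_skewPoly, h]
  have h3 := RelFree.mk_eq_zero_iff.1 h1 A hI y
  rw [map_skewPoly] at h3
  simpa only [hs] using h3

theorem basicRank_eq_top
    (hN : ∀ m : ℕ, ∃ N : ℕ, 1 ≤ N ∧ ∀ x : Fin N → RelFree I (Fin m), skewPoly N x = 0)
    (hne : ∀ k : ℕ, 1 ≤ k → skewPoly k (fun i : Fin k => RelFree.gen I ℕ (i : ℕ)) ≠ 0) :
    basicRank I = ⊤ := by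
  have hempty : {r : ℕ∞ | ∃ n : ℕ, r = n ∧ GeneratedInRank I n} = ∅ := by
    rw [Set.eq_empty_iff_forall_notMem]
    rintro _ ⟨n, rfl, hn⟩
    obtain ⟨N, hN1, hN⟩ := hN n
    apply hne N hN1
    have hid : skewPoly N (fun i : Fin N => FreeNonUnitalNonAssocAlgebra.of F (i : ℕ)) ∈
        identitiesOf F (RelFree I (Fin n)) := fun φ => by rw [map_skewPoly, hN]
    have h := (hn (RelFree I ℕ)).2 (RelFree.inVariety I ℕ) hid (RelFree.gen I ℕ)
    rw [map_skewPoly] at h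
    simpa only [FreeNonUnitalNonAssocAlgebra.lift_of_apply] using h
  rw [basicRank, hempty, sInf_empty]

theorem skewPoly_gen_ne_zero {A : Type u} [NonUnitalNonAssocRing A] [Module F A]
    [IsScalarTower F A A] [SMulCommClass F A A] (hI : InVariety I A) {k : ℕ} {x : Fin k → A}
    (hx : skewPoly k x ≠ 0) :
    skewPoly k (fun i : Fin k => RelFree.gen I ℕ (i : ℕ)) ≠ 0 := by
  intro h
  have h1 : RelFree.mk I ℕ
      (skewPoly k (fun i : Fin k => FreeNonUnitalNonAssocAlgebra.of F (i : ℕ))) = 0 := by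
    rw [map_skewPoly]; exact h
  -- Variables beyond the first k do not occur, so their value 0 is arbitrary.
  have h2 := RelFree.mk_eq_zero_iff.1 h1 A hI fun i => if h : i < k then x ⟨i, h⟩ else 0
  rw [map_skewPoly] at h2
  apply hx
  simpa only [FreeNonUnitalNonAssocAlgebra.lift_of_apply, Fin.is_lt, dite_true, Fin.eta] using h2

end Main

/-! ### An alternative algebra on which no f_k vanishes -/

section Example

variable (F : Type u) [Field F] (V : Type u) [AddCommGroup V] [Module F V]

/-- A split null extension of a space `V` with zero product by the bimodule `E × E`, where `E` is
the exterior algebra of `V`. -/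
def NullExtension : Type u := V × ExteriorAlgebra F V × ExteriorAlgebra F V

namespace NullExtension

noncomputable instance : AddCommGroup (NullExtension F V) :=
  inferInstanceAs (AddCommGroup (V × ExteriorAlgebra F V × ExteriorAlgebra F V))

noncomputable instance : Module F (NullExtension F V) :=
  inferInstanceAs (Module F (V × ExteriorAlgebra F V × ExteriorAlgebra F V))

variable {F V}

/-- The element with the given coordinates. -/
def of (x : V) (a b : ExteriorAlgebra F V) : NullExtension F V := (x, a, b)

theorem exists_eq_of (z : NullExtension F V) : ∃ x a b, z = of x a b := ⟨z.1, z.2.1, z.2.2, rfl⟩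

theorem of_add (x y : V) (a b c d : ExteriorAlgebra F V) :
    of x a b + of y c d = of (x + y) (a + c) (b + d) := rfl

theorem of_sub (x y : V) (a b c d : ExteriorAlgebra F V) :
    of x a b - of y c d = of (x - y) (a - c) (b - d) := rfl

theorem smul_of (t : F) (x : V) (a b : ExteriorAlgebra F V) :
    t • of x a b = of (t • x) (t • a) (t • b) := rfl

theorem zero_eq : (0 : NullExtension F V) = of 0 0 0 := rfl

theorem of_inj {x y : V} {a b c d : ExteriorAlgebra F V} :
    of x a b = of y c d ↔ x = y ∧ a = c ∧ b = d :=
  ⟨fun h => ⟨congrArg (fun z => z.1) h, congrArg (fun z => z.2.1) h, congrArg (fun z => z.2.2) h⟩,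
    by rintro ⟨rfl, rfl, rfl⟩; rfl⟩

/-- On pairs (a, b), left and right multiplication by x ∈ V are the matrices L: (a, b) ↦ (b, a) and
R: (a, b) ↦ (a, -a-b), each followed by exterior multiplication by x. -/
noncomputable instance : Mul (NullExtension F V) where
  mul z w := of 0
    (w.2.2 * ExteriorAlgebra.ι F z.1 + z.2.1 * ExteriorAlgebra.ι F w.1)
    (w.2.1 * ExteriorAlgebra.ι F z.1 - (z.2.1 + z.2.2) * ExteriorAlgebra.ι F w.1)

theorem of_mul (x y : V) (a b c d : ExteriorAlgebra F V) :
    of x a b * of y c d = of 0 (d * ExteriorAlgebra.ι F x + a * ExteriorAlgebra.ι F y)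
      (c * ExteriorAlgebra.ι F x - (a + b) * ExteriorAlgebra.ι F y) := rfl

noncomputable instance : NonUnitalNonAssocRing (NullExtension F V) where
  left_distrib z w u := by
    obtain ⟨x, a, b, rfl⟩ := exists_eq_of z
    obtain ⟨y, c, d, rfl⟩ := exists_eq_of w
    obtain ⟨v, e, f, rfl⟩ := exists_eq_of u
    simp only [of_mul, of_add, of_inj, map_add, add_mul, mul_add, add_zero, true_and]
    constructor <;> abel
  right_distrib z w u := by
    obtain ⟨x, a, b, rfl⟩ := exists_eq_of z
    obtain ⟨y, c, d, rfl⟩ := exists_eq_of w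
    obtain ⟨v, e, f, rfl⟩ := exists_eq_of u
    simp only [of_mul, of_add, of_inj, map_add, add_mul, mul_add, add_zero, true_and]
    constructor <;> abel
  zero_mul z := by
    obtain ⟨x, a, b, rfl⟩ := exists_eq_of z
    simp [of_mul, zero_eq]
  mul_zero z := by
    obtain ⟨x, a, b, rfl⟩ := exists_eq_of z
    simp [of_mul, zero_eq]

instance : IsScalarTower F (NullExtension F V) (NullExtension F V) where
  smul_assoc t z w := by
    obtain ⟨x, a, b, rfl⟩ := exists_eq_of z
    obtain ⟨y, c, d, rfl⟩ := exists_eq_of w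
    simp [of_mul, smul_of, ← smul_add, ← smul_sub]

instance : SMulCommClass F (NullExtension F V) (NullExtension F V) where
  smul_comm t z w := by
    obtain ⟨x, a, b, rfl⟩ := exists_eq_of z
    obtain ⟨y, c, d, rfl⟩ := exists_eq_of w
    simp [of_mul, smul_of, smul_add, smul_sub]

theorem ι_mul_ι_comm (x y : V) (a : ExteriorAlgebra F V) :
    a * ExteriorAlgebra.ι F y * ExteriorAlgebra.ι F x =
      -(a * ExteriorAlgebra.ι F x * ExteriorAlgebra.ι F y) := by
  rw [mul_assoc, mul_assoc, eq_neg_of_add_eq_zero_left (ExteriorAlgebra.ι_add_mul_swap y x),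
    mul_neg]

theorem ι_mul_ι_self (x : V) (a : ExteriorAlgebra F V) :
    a * ExteriorAlgebra.ι F x * ExteriorAlgebra.ι F x = 0 := by
  rw [mul_assoc, ExteriorAlgebra.ι_sq_zero, mul_zero]

-- As vectors of V anticommute in E, what is needed is RL + LR + R² = 0 = RL + LR + L²; indeed L² =
-- R² = 1 and RL + LR = -1.
variable (F V) in
theorem isAlternative : IsAlternative (NullExtension F V) := by
  constructor
  · intro z w
    obtain ⟨x, a, b, rfl⟩ := exists_eq_of z
    obtain ⟨y, c, d, rfl⟩ := exists_eq_of w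
    simp only [associator, of_mul, of_sub, zero_eq, of_inj, map_zero, mul_zero, add_mul, sub_mul,
      ι_mul_ι_self, ι_mul_ι_comm y x, sub_self, true_and]
    constructor <;> abel
  · intro z w
    obtain ⟨x, a, b, rfl⟩ := exists_eq_of z
    obtain ⟨y, c, d, rfl⟩ := exists_eq_of w
    simp only [associator, of_mul, of_sub, zero_eq, of_inj, map_zero, mul_zero, add_mul, sub_mul,
      ι_mul_ι_self, ι_mul_ι_comm y x, sub_self, true_and]
    constructor <;> abel

theorem ι_mul_ιMulti_removeNth {m : ℕ} (v : Fin (m + 1) → V) (j : Fin (m + 1)) :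
    ExteriorAlgebra.ι F (v j) * ExteriorAlgebra.ιMulti F m (j.removeNth v) =
      (-1 : ℤ) ^ (j : ℕ) • ExteriorAlgebra.ιMulti F (m + 1) v := by
  have h := (ExteriorAlgebra.ιMulti F (m + 1)).neg_one_pow_smul_map_insertNth j (v j)
    (j.removeNth v)
  rw [Fin.insertNth_self_removeNth] at h
  have h' := ExteriorAlgebra.ιMulti_succ_apply (R := F) (Matrix.vecCons (v j) (j.removeNth v))
  rw [← h] at h'
  simpa [Matrix.vecCons, Matrix.vecTail] using h'.symm

/-- Since V has zero product, only the commutators of the first argument with the v_j survive; they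
act by R - L, of determinant -3. -/
theorem skewAlt_succ_of (m : ℕ) (v : Fin (m + 1) → V) (a b : ExteriorAlgebra F V) :
    skewAlt F (NullExtension F V) (m + 1) (Fin.cons (of 0 a b) fun i => of (v i) 0 0) =
      ∑ j : Fin (m + 1), (-1 : ℤ) ^ (j : ℕ) • skewAlt F (NullExtension F V) m
        (Fin.cons (of 0 ((a - b) * ExteriorAlgebra.ι F (v j))
          ((-(a + a + b)) * ExteriorAlgebra.ι F (v j))) fun i => of (j.removeNth v i) 0 0) := by
  set X : Fin (m + 1) → NullExtension F V := fun i => of (v i) 0 0 with hX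
  have hXX : ∀ i j, X i * X j = 0 := fun i j => by simp [hX, of_mul, zero_eq]
  have h0 : (0 : Fin (m + 2)).removeNth (Fin.cons (of 0 a b) X : Fin (m + 2) → _) = X := by simp
  have h1 : ∀ i : Fin (m + 1), i.succ.removeNth (Fin.cons (of 0 a b) X : Fin (m + 2) → _) =
      (Fin.cons (of 0 a b) (i.removeNth X) : Fin (m + 1) → _) := by
    intro i
    funext j
    refine Fin.cases ?_ (fun j => ?_) j <;> simp [Fin.removeNth]
  have h2 : ∀ i : Fin (m + 1), (0 : Fin (m + 1)).removeNth
      (Fin.cons (of 0 a b) (i.removeNth X) : Fin (m + 1) → _) = i.removeNth X := by simp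
  have h3 : ∀ u : Fin m → NullExtension F V, skewAlt F (NullExtension F V) m (Fin.cons 0 u) = 0 :=
    fun u => AlternatingMap.map_coord_zero _ (0 : Fin (m + 1)) (by simp)
  have inner : ∀ i : Fin (m + 1), ∑ j : Fin (m + 1), (-1) ^ (j : ℕ) •
      skewAlt F (NullExtension F V) m (Fin.cons
        (X i * (Fin.cons (of 0 a b) (i.removeNth X) : Fin (m + 1) → _) j)
        (j.removeNth (Fin.cons (of 0 a b) (i.removeNth X) : Fin (m + 1) → _))) =
      skewAlt F (NullExtension F V) m (Fin.cons (X i * of 0 a b) (i.removeNth X)) := by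
    intro i
    rw [Fin.sum_univ_succ, Finset.sum_eq_zero, add_zero, h2]
    · simp
    · intro j _
      rw [Fin.cons_succ, Fin.removeNth, hXX, h3, smul_zero]
  rw [skewAlt_succ_apply, Fin.sum_univ_succ]
  simp only [h0, h1, Fin.cons_zero, Fin.cons_succ, inner]
  simp only [Fin.val_zero, Fin.val_succ, pow_succ, mul_neg, mul_one, neg_smul, pow_zero, one_smul,
    Finset.sum_neg_distrib]
  rw [← sub_eq_add_neg, ← Finset.sum_sub_distrib]
  refine Finset.sum_congr rfl fun j _ => ?_
  rw [← smul_sub, ← map_cons_sub]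
  congr 4
  simp only [hX, of_mul, of_sub, of_inj]
  simp [sub_mul, add_mul]
  abel

/-- For fixed `x_1, …, x_m` in `V` the polynomial `f_{m+1}` acts on `E × E` as a nonsingular matrix
times the multiplication by the exterior product of `x_1, …, x_m`. -/
theorem exists_skewAlt_of [CharZero F] (m : ℕ) : ∃ α β γ δ : F, α * δ - β * γ ≠ 0 ∧
    ∀ (v : Fin m → V) (a b : ExteriorAlgebra F V),
      skewAlt F (NullExtension F V) m (Fin.cons (of 0 a b) fun i => of (v i) 0 0) =
        of 0 ((α • a + β • b) * ExteriorAlgebra.ιMulti F m v)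
          ((γ • a + δ • b) * ExteriorAlgebra.ιMulti F m v) := by
  induction m with
  | zero =>
    refine ⟨1, 0, 0, 1, by simp, fun v a b => ?_⟩
    simp [skewAlt]
  | succ m ih =>
    obtain ⟨α, β, γ, δ, hdet, h⟩ := ih
    have hm : ((m : F) + 1) ≠ 0 := Nat.cast_add_one_ne_zero m
    refine ⟨(m + 1) * (α - 2 * β), (m + 1) * (-α - β), (m + 1) * (γ - 2 * δ),
      (m + 1) * (-γ - δ), ?_, fun v a b => ?_⟩
    · have e : (m + 1) * (α - 2 * β) * ((m + 1) * (-γ - δ)) -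
          (m + 1) * (-α - β) * ((m + 1) * (γ - 2 * δ)) =
          (m + 1) ^ 2 * ((-3) * (α * δ - β * γ)) := by ring
      rw [e]
      exact mul_ne_zero (pow_ne_zero _ hm) (mul_ne_zero (by norm_num) hdet)
    · rw [skewAlt_succ_of]
      have hterm : ∀ j : Fin (m + 1), (-1 : ℤ) ^ (j : ℕ) • skewAlt F (NullExtension F V) m
          (Fin.cons (of 0 ((a - b) * ExteriorAlgebra.ι F (v j))
            ((-(a + a + b)) * ExteriorAlgebra.ι F (v j))) fun i => of (j.removeNth v i) 0 0) =
          of 0 (((α - 2 * β) • a + (-α - β) • b) * ExteriorAlgebra.ιMulti F (m + 1) v)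
            (((γ - 2 * δ) • a + (-γ - δ) • b) * ExteriorAlgebra.ιMulti F (m + 1) v) := by
        -- The sign from moving v_j to its place in the exterior product cancels the sign of the
        -- sum, so all m + 1 terms agree.
        intro j
        rw [h]
        have e : ∀ s t : F, (s • ((a - b) * ExteriorAlgebra.ι F (v j)) +
            t • ((-(a + a + b)) * ExteriorAlgebra.ι F (v j))) *
              ExteriorAlgebra.ιMulti F m (j.removeNth v) = (-1 : ℤ) ^ (j : ℕ) •
            (((s - 2 * t) • a + (-s - t) • b) * ExteriorAlgebra.ιMulti F (m + 1) v) := by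
          intro s t
          rw [← smul_mul_assoc, ← smul_mul_assoc, ← add_mul, mul_assoc, ι_mul_ιMulti_removeNth,
            mul_smul_comm]
          congr 2
          module
        rw [e, e]
        rcases neg_one_pow_eq_or ℤ (j : ℕ) with hs | hs
        · rw [hs, one_smul, one_smul, one_smul]
        · rw [hs, neg_one_smul, neg_one_smul, neg_one_smul, ← zero_sub, zero_eq, of_sub]
          simp only [sub_zero, zero_sub, neg_neg]
      rw [Finset.sum_congr rfl fun j _ => hterm j, Finset.sum_const, Finset.card_univ,
        Fintype.card_fin, ← Nat.cast_smul_eq_nsmul F, smul_of, of_inj]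
      refine ⟨smul_zero _, ?_, ?_⟩
      · rw [← smul_mul_assoc]; congr 1; push_cast; module
      · rw [← smul_mul_assoc]; congr 1; push_cast; module

end NullExtension

theorem ιMulti_single_ne_zero (m : ℕ) :
    ExteriorAlgebra.ιMulti F m (fun i : Fin m => (Pi.single i 1 : Fin m → F)) ≠ 0 := by
  intro h
  -- The determinant, extended by zero in the other degrees, takes the value 1 on this product.
  have := ExteriorAlgebra.liftAlternating_apply_ιMulti (R := F)
    (Function.update (fun _ => 0) m (Matrix.detRowAlternating (n := Fin m) (R := F)))
    (fun i : Fin m => (Pi.single i 1 : Fin m → F))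
  rw [h, map_zero, Function.update_self] at this
  have hdet : Matrix.det (1 : Matrix (Fin m) (Fin m) F) = 0 := by
    rw [this]
    congr 1
    ext i j
    simp [Matrix.one_apply, Pi.single_apply, eq_comm]
  simp at hdet

theorem exists_skewPoly_nullExtension_ne_zero [CharZero F] (k : ℕ) (hk : 1 ≤ k) :
    ∃ x : Fin k → NullExtension F (Fin (k - 1) → F), skewPoly k x ≠ 0 := by
  obtain ⟨m, rfl⟩ : ∃ m, k = m + 1 := ⟨k - 1, by omega⟩
  obtain ⟨α, β, γ, δ, hdet, h⟩ := NullExtension.exists_skewAlt_of (F := F) (V := Fin m → F) m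
  refine ⟨Fin.cons (.of 0 1 0) fun i : Fin m => .of (Pi.single i 1) 0 0, ?_⟩
  rw [skewPoly_succ (F := F)]
  intro h0
  have h1 := h (fun i => Pi.single i 1) 1 0
  have h2 := h1.symm.trans h0
  rw [NullExtension.zero_eq, NullExtension.of_inj] at h2
  have hne := ιMulti_single_ne_zero F m
  simp only [smul_zero, add_zero, smul_mul_assoc, one_mul, smul_eq_zero, hne, or_false,
    true_and] at h2
  -- Vanishing on (a, b) = (1, 0) would make the first column (α, γ) zero.
  apply hdet
  rw [h2.1, h2.2]
  simp

end Example

end FlexVar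

theorem mainTheorem2 {F : Type u} [Field F] (hF : ringChar F ≠ 2)
    (I : Set (FreeNonUnitalNonAssocAlgebra F ℕ))
    (hflex : ∀ (A : Type u) [NonUnitalNonAssocRing A] [Module F A] [IsScalarTower F A A]
      [SMulCommClass F A A], FlexVar.InVariety I A → FlexVar.IsFlexible A)
    (hnil : ∀ (A : Type u) [NonUnitalNonAssocRing A] [Module F A] [IsScalarTower F A A]
      [SMulCommClass F A A], FlexVar.InVariety I A → FlexVar.IsFinGenerated F A →
        FlexVar.IsAnticommutative A → FlexVar.IsNilpotentAlgebra A)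
    (hhom : Infinite F ∨ FlexVar.IsHomogeneousVariety I) :
    (∀ m : ℕ, ∃ N : ℕ, 1 ≤ N ∧
      ∀ (A : Type u) [NonUnitalNonAssocRing A] [Module F A] [IsScalarTower F A A]
        [SMulCommClass F A A], FlexVar.InVariety I A → FlexVar.IsGeneratedBy F A m →
          ∀ x : Fin N → A, FlexVar.skewPoly N x = 0) ∧
    ((∀ k : ℕ, 1 ≤ k →
        FlexVar.skewPoly k (fun i : Fin k => FlexVar.RelFree.gen I ℕ (i : ℕ)) ≠ 0) →
      FlexVar.basicRank I = ⊤) ∧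
    (CharZero F →
      (∀ (A : Type u) [NonUnitalNonAssocRing A] [Module F A] [IsScalarTower F A A]
        [SMulCommClass F A A], FlexVar.IsAlternative A → FlexVar.InVariety I A) →
      (∀ k : ℕ, 1 ≤ k →
        FlexVar.skewPoly k (fun i : Fin k => FlexVar.RelFree.gen I ℕ (i : ℕ)) ≠ 0) ∧
      FlexVar.basicRank I = ⊤) := by
  have h2 : (2 : F) ≠ 0 := Ring.two_ne_zero hF
  have hhom' : FlexVar.IsHomogeneousVariety I :=
    hhom.elim (fun _ => FlexVar.isHomogeneousVariety_of_infinite I) id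
  have hN := FlexVar.exists_skewPoly_relFree_eq_zero h2 hflex hnil hhom'
  refine ⟨fun m => ?_, FlexVar.basicRank_eq_top hN, fun _ halt => ?_⟩
  · obtain ⟨N, hN1, hN⟩ := hN m
    exact ⟨N, hN1, fun A _ _ _ _ hI hA x => FlexVar.skewPoly_eq_zero_of_relFree hN hI hA x⟩
  · have hne : ∀ k : ℕ, 1 ≤ k →
        FlexVar.skewPoly k (fun i : Fin k => FlexVar.RelFree.gen I ℕ (i : ℕ)) ≠ 0 := by
      intro k hk
      obtain ⟨x, hx⟩ := FlexVar.exists_skewPoly_nullExtension_ne_zero F k hk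
      exact FlexVar.skewPoly_gen_ne_zero (halt _ (FlexVar.NullExtension.isAlternative F _)) hx
    exact ⟨hne, FlexVar.basicRank_eq_top hN hne⟩
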